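/- Let $\widehat{\mathbb C}=\mathbb C\cup\{\infty\}$. For a function $f$ meromorphic in $\mathbb C$, regarded as a map $f\colon\mathbb C\to\widehat{\mathbb C}$, the iterate $f^k$ is defined at $z$ if none of $z,f(z),\dots,f^{k-1}(z)$ equals $\infty$. The Fatou set $F(f)$ is the set of all $z\in\mathbb C$ having a neighbourhood in which all iterates $f^k$ are defined and form a normal family (with respect to the spherical metric), the Julia set is $J(f)=\widehat{\mathbb C}\setminus F(f)$, and $\dim$ denotes Hausdorff dimension. Let $f$ be an elliptic function, that is, a non-constant meromorphic function $\mathbb C\to\widehat{\mathbb C}$ having two periods that are linearly independent over $\mathbb R$, and let $q$ be the maximal multiplicity of the poles of $f$. Then $$\dim J(f)>\frac{2q}{q+1}.$$ Moreover, if $(f_n)$ is a sequence of functions meromorphic in $\mathbb C$ which converges to $f$ locally uniformly in $\mathbb C$ (with respect to the spherical metric), then $$\dim J(f_n)>\frac{2q}{q+1}$$ for all sufficiently large $n$. -/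

import Mathlib

open Set Filter Topology OnePoint

namespace MeromorphicDynamics

/-- The chordal metric on the Riemann sphere `OnePoint ℂ`. -/
noncomputable def chordalDist : OnePoint ℂ → OnePoint ℂ → ℝ
  | ∞, ∞ => 0
  | ∞, OnePoint.some w => 2 / √(1 + ‖w‖ ^ 2)
  | OnePoint.some z, ∞ => 2 / √(1 + ‖z‖ ^ 2)
  | OnePoint.some z, OnePoint.some w =>
      2 * ‖z - w‖ / (√(1 + ‖z‖ ^ 2) * √(1 + ‖w‖ ^ 2))

/-- Locally uniform convergence `g n → g` on an open set `U ⊆ ℂ` of maps into the Riemann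
sphere: uniform convergence on compact subsets of `U` with respect to the chordal metric. -/
def TendstoLocUnif (g : ℕ → ℂ → OnePoint ℂ) (g₀ : ℂ → OnePoint ℂ) (U : Set ℂ) : Prop :=
  ∀ K ⊆ U, IsCompact K → ∀ ε > 0, ∀ᶠ n in atTop, ∀ z ∈ K, chordalDist (g n z) (g₀ z) < ε

/-- A family of maps into the Riemann sphere is normal on the open set `U` if every sequence in
the family has a subsequence which converges locally uniformly on `U`. -/
def IsNormalFamily (𝓕 : Set (ℂ → OnePoint ℂ)) (U : Set ℂ) : Prop :=
  ∀ s : ℕ → ℂ → OnePoint ℂ, (∀ n, s n ∈ 𝓕) →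
    ∃ φ : ℕ → ℕ, StrictMono φ ∧ ∃ g : ℂ → OnePoint ℂ, TendstoLocUnif (fun n => s (φ n)) g U

/-- A meromorphic function in the complex plane. Mathlib's normal form singles out the
representative which is analytic away from the poles, and takes the default value `0` at them;
the associated map into the sphere is `toSphere`. -/
def IsMeromorphicFun (f : ℂ → ℂ) : Prop := MeromorphicNFOn f univ

/-- `f` has a pole of multiplicity `m` (with `m ≥ 1`) at `a`. -/
def HasPole (f : ℂ → ℂ) (a : ℂ) (m : ℕ) : Prop :=
  1 ≤ m ∧ meromorphicOrderAt f a = ((-(m : ℤ) : ℤ) : WithTop ℤ)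

open Classical in
/-- A meromorphic function as a map `ℂ → ℂ ∪ {∞}`, with value `∞` at the poles. -/
noncomputable def toSphere (f : ℂ → ℂ) (z : ℂ) : OnePoint ℂ :=
  if ∃ m, HasPole f z m then ∞ else (f z : OnePoint ℂ)

/-- The iterates `f^k`. Here `f^(k+1)(z) = f(f^k(z))` is meaningful only if `f^k(z) ≠ ∞`;
the value `∞` is used as a default otherwise, see `IterDefined`. -/
noncomputable def iter (f : ℂ → ℂ) : ℕ → ℂ → OnePoint ℂ
  | 0, z => (z : OnePoint ℂ)
  | k + 1, z => (iter f k z).elim ∞ (toSphere f)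

/-- `f^k` is defined at `z`: none of `z, f(z), …, f^(k-1)(z)` is `∞`. -/
def IterDefined (f : ℂ → ℂ) (k : ℕ) (z : ℂ) : Prop := ∀ j < k, iter f j z ≠ ∞

/-- The Fatou set: the points of `ℂ` that have a neighbourhood in which all iterates of `f`
are defined and form a normal family. -/
def fatouSet (f : ℂ → ℂ) : Set ℂ :=
  {z | ∃ U : Set ℂ, IsOpen U ∧ z ∈ U ∧ (∀ k, ∀ w ∈ U, IterDefined f k w) ∧
    IsNormalFamily (range (iter f)) U}

/-- The Julia set: the complement of the Fatou set in the Riemann sphere. -/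
def juliaSet (f : ℂ → ℂ) : Set (OnePoint ℂ) := (((↑) : ℂ → OnePoint ℂ) '' fatouSet f)ᶜ

/-- The Hausdorff dimension of a subset of the Riemann sphere, measured in the plane
(the single point `∞` does not contribute to the dimension). -/
noncomputable def sphereDim (A : Set (OnePoint ℂ)) : ENNReal := dimH (((↑) : ℂ → OnePoint ℂ) ⁻¹' A)

/-- An elliptic function: a non-constant meromorphic function in the plane with two periods
that are linearly independent over `ℝ`. -/
def IsElliptic (f : ℂ → ℂ) : Prop :=
  IsMeromorphicFun f ∧ (¬ ∃ c, ∀ z, f z = c) ∧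
    ∃ ω₁ ω₂ : ℂ, LinearIndependent ℝ ![ω₁, ω₂] ∧
      Function.Periodic f ω₁ ∧ Function.Periodic f ω₂

end MeromorphicDynamics

namespace MeromorphicDynamics

/-! Let `a` be a pole of multiplicity `q` and let `b_j` be lattice translates of `a`. Near `a` the
function behaves like `(z - a)^(-q)`, so it takes each large value `b_j` at the centre of a small
disc on which it is almost affine, with slope `A_j` satisfying `|A_j|^q ≤ C |b_j|^(q+1)`, and which
it maps over a fixed-size disc about `b_j` (`exists_disc_near_pole`). By periodicity the same
happens near every `b_i`, with the same slope. Finitely many `b_j` thus give a full expanding Markov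
system whose expansion bound `L j = 2 |A_j|` depends only on the target `j`.

For such a system the limit set has dimension at least `t` once `∑ (L j)^(-t) ≥ 1`
(`IsMarkovSystem.le_dimH`). At `t = 2q/(q+1)` the terms are at least a constant times `|b_j|^(-2)`,
whose sum over the lattice diverges. So a finite subsystem has sum at least `2`
(`exists_sector_sum`), and there is room for a strictly larger exponent (`exists_exponent`).

Expansion and separation of itineraries keep the limit set out of the Fatou set
(`IsMarkovSystem.notMem_fatouSet`). Only finitely many discs are involved, so the system, with the
same `L`, survives small perturbations (`eventually_isMarkovSystem`). -/

/-! ### Symbolic coding and Hausdorff dimension -/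

/-- One step of the expansion of a real number in `[0, 1)` with respect to the weights `p`. -/
theorem exists_digit {ι : Type*} [Fintype ι] (p : ι → ℝ) (hp : ∀ i, 0 < p i)
    (hsum : ∑ i, p i = 1) :
    ∃ a : ι → ℝ, ∀ y ∈ Ico (0 : ℝ) 1, ∃ i, ∃ y' ∈ Ico (0 : ℝ) 1, y = a i + p i * y' := by
  classical
  suffices H : ∀ s : Finset ι, ∃ a : ι → ℝ, ∀ y ∈ Ico (0 : ℝ) (∑ i ∈ s, p i),
      ∃ i, ∃ y' ∈ Ico (0 : ℝ) 1, y = a i + p i * y' by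
    obtain ⟨a, ha⟩ := H Finset.univ
    exact ⟨a, fun y hy => ha y (by rwa [hsum])⟩
  intro s
  suffices H : ∃ a : ι → ℝ, ∀ y ∈ Ico (0 : ℝ) (∑ i ∈ s, p i),
      ∃ i ∈ s, ∃ y' ∈ Ico (0 : ℝ) 1, y = a i + p i * y' by
    obtain ⟨a, ha⟩ := H
    exact ⟨a, fun y hy => let ⟨i, _, h⟩ := ha y hy; ⟨i, h⟩⟩
  induction s using Finset.induction_on with
  | empty => exact ⟨0, fun y hy => by simp at hy⟩
  | insert i s hi ih =>
    obtain ⟨a, ha⟩ := ih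
    -- Intervals of lengths `p j` are laid end to end; `a` records left endpoints, and the new
    -- interval goes to the right of the old ones.
    refine ⟨Function.update a i (∑ j ∈ s, p j), fun y hy => ?_⟩
    rw [Finset.sum_insert hi] at hy
    by_cases hlt : y < ∑ j ∈ s, p j
    · obtain ⟨j, hj, y', hy', h⟩ := ha y ⟨hy.1, hlt⟩
      refine ⟨j, Finset.mem_insert_of_mem hj, y', hy', ?_⟩
      rw [Function.update_of_ne (ne_of_mem_of_not_mem hj hi), h]
    · refine ⟨i, Finset.mem_insert_self _ _, (y - ∑ j ∈ s, p j) / p i, ⟨?_, ?_⟩, ?_⟩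
      · exact div_nonneg (by linarith) (hp i).le
      · rw [div_lt_one (hp i)]
        linarith [hy.2]
      · rw [Function.update_self]
        have := (hp i).ne'
        field_simp
        ring

/-- Expansions of the real numbers in `[0, 1)` with respect to the weights `p`: numbers whose
expansions agree in the first `m` places are close. -/
theorem exists_expansion {ι : Type*} [Fintype ι] (p : ι → ℝ) (hp : ∀ i, 0 < p i)
    (hsum : ∑ i, p i = 1) :
    ∃ c : ℝ → ℕ → ι, ∀ y ∈ Ico (0 : ℝ) 1, ∀ y' ∈ Ico (0 : ℝ) 1, ∀ m,
      (∀ j < m, c y j = c y' j) → |y - y'| ≤ ∏ j ∈ Finset.range m, p (c y j) := by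
  obtain ⟨a, ha⟩ := exists_digit p hp hsum
  have : Nonempty ι := let ⟨i, _⟩ := ha 0 (by simp); ⟨i⟩
  choose! d T hT hd using ha
  refine ⟨fun y n => d (T^[n] y), fun y hy y' hy' m => ?_⟩
  induction m generalizing y y' with
  | zero =>
    intro _
    simp only [Finset.range_zero, Finset.prod_empty]
    rw [abs_le]
    constructor <;> linarith [hy.1, hy.2, hy'.1, hy'.2]
  | succ m ih =>
    intro h
    have h0 : d y = d y' := h 0 (Nat.succ_pos m)
    have := ih (T y) (hT y hy) (T y') (hT y' hy') fun j hj => by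
      simpa using h (j + 1) (by omega)
    rw [Finset.prod_range_succ']
    have e : y - y' = p (d y) * (T y - T y') := by
      conv_lhs => rw [hd y hy, hd y' hy', ← h0]
      ring
    rw [e, abs_mul, abs_of_pos (hp _), mul_comm]
    simpa using mul_le_mul_of_nonneg_right this (hp (d y)).le

/-- A lower bound for the Hausdorff dimension of a set coded by a symbolic space. -/
theorem le_dimH_of_coding {ι X : Type*} [Fintype ι] [MetricSpace X] (p : ι → ℝ)
    (hp : ∀ i, 0 < p i) (hp1 : ∀ i, p i < 1) (hsum : ∑ i, p i = 1) (t C : NNReal) (ht : 0 < t)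
    (π : (ℕ → ι) → X)
    (hπ : ∀ x x' : ℕ → ι, ∀ m, (∀ j < m, x j = x' j) → x m ≠ x' m →
      ∏ j ∈ Finset.range m, p (x j) ≤ C * dist (π x) (π x') ^ (t : ℝ)) :
    (t : ENNReal) ≤ dimH (range π) := by
  obtain ⟨c, hc⟩ := exists_expansion p hp hsum
  have : Nonempty ι := by
    by_contra h
    rw [not_nonempty_iff] at h
    simp at hsum
  obtain ⟨i₀, hi₀⟩ := Finite.exists_max p
  -- This makes the inverse of `y ↦ π (c y)` Hölder of exponent `t`. It maps a subset of `range π`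
  -- onto `[0, 1)`, and such a map raises dimension by at most the factor `1 / t`.
  have key : ∀ y ∈ Ico (0 : ℝ) 1, ∀ y' ∈ Ico (0 : ℝ) 1,
      dist y y' ≤ C * dist (π (c y)) (π (c y')) ^ (t : ℝ) := by
    intro y hy y' hy'
    by_cases hne : ∃ m, c y m ≠ c y' m
    · classical
      have h1 : ∀ j < Nat.find hne, c y j = c y' j := fun j hj => by
        simpa using Nat.find_min hne hj
      exact (hc y hy y' hy' _ h1).trans (hπ _ _ _ h1 (Nat.find_spec hne))
    · push Not at hne
      have h1 : ∀ m : ℕ, |y - y'| ≤ p i₀ ^ m := fun m => by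
        refine (hc y hy y' hy' m fun j _ => hne j).trans ?_
        calc _ ≤ ∏ j ∈ Finset.range m, p i₀ :=
              Finset.prod_le_prod (fun _ _ => (hp _).le) fun _ _ => hi₀ _
          _ = _ := by simp
      have h2 : |y - y'| ≤ 0 :=
        ge_of_tendsto' (tendsto_pow_atTop_nhds_zero_of_lt_one (hp i₀).le (hp1 i₀)) h1
      rw [Real.dist_eq]
      exact h2.trans (by positivity)
  have hinj : InjOn (fun y => π (c y)) (Ico (0 : ℝ) 1) := by
    intro y hy y' hy' h
    have := key y hy y' hy'
    simp only at h
    rw [h, dist_self, Real.zero_rpow (by exact_mod_cast ht.ne'), mul_zero] at this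
    exact dist_le_zero.1 this
  set E := (fun y => π (c y)) '' Ico (0 : ℝ) 1
  set h := Function.invFunOn (fun y => π (c y)) (Ico (0 : ℝ) 1)
  have hh : ∀ y ∈ Ico (0 : ℝ) 1, h (π (c y)) = y := fun y hy =>
    hinj.leftInvOn_invFunOn hy
  have hH : HolderOnWith C t h E := by
    rintro _ ⟨y, hy, rfl⟩ _ ⟨y', hy', rfl⟩
    simp only [hh y hy, hh y' hy']
    rw [edist_dist, edist_dist, ENNReal.ofReal_rpow_of_nonneg dist_nonneg (by positivity),
      ← ENNReal.ofReal_coe_nnreal, ← ENNReal.ofReal_mul (NNReal.coe_nonneg C)]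
    exact ENNReal.ofReal_le_ofReal (key y hy y' hy')
  have himg : h '' E = Ico (0 : ℝ) 1 := by
    rw [image_image]
    ext y
    constructor
    · rintro ⟨y', hy', rfl⟩
      simpa only [hh y' hy'] using hy'
    · exact fun hy => ⟨y, hy, hh y hy⟩
  have h1 := hH.dimH_image_le ht
  rw [himg, Real.dimH_of_nonempty_interior (by simp), ENNReal.le_div_iff_mul_le
    (Or.inl (by exact_mod_cast ht.ne')) (Or.inl (by simp)), Module.finrank_self, Nat.cast_one,
    one_mul] at h1
  refine h1.trans (dimH_mono ?_)
  rintro _ ⟨y, _, rfl⟩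
  exact ⟨_, rfl⟩

/-! ### Expanding Markov systems and their limit sets -/

/-- A finite expanding system for `F`: the set `B i` contains for each `j` a piece `P i j`
whose image contains `B j`, with expansion factors between `2` and `L j`. -/
structure IsMarkovSystem {ι : Type*} (F : ℂ → ℂ) (B : ι → Set ℂ) (P : ι → ι → Set ℂ)
    (L : ι → ℝ) (δ : ℝ) : Prop where
  nonempty : ∀ i, (B i).Nonempty
  bounded : ∃ M, ∀ i, ∀ z ∈ B i, ‖z‖ ≤ M
  subset : ∀ i j, P i j ⊆ B i
  compact : ∀ i j, IsCompact (P i j)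
  cont : ∀ i j, ∀ z ∈ P i j, ContinuousAt F z
  surj : ∀ i j, SurjOn F (P i j) (B j)
  lip : ∀ i j, ∀ z ∈ P i j, ∀ z' ∈ P i j, dist (F z) (F z') ≤ L j * dist z z'
  expand : ∀ i j, ∀ z ∈ P i j, ∀ z' ∈ P i j, 2 * dist z z' ≤ dist (F z) (F z')
  pos : 0 < δ
  sep : ∀ i j, i ≠ j → ∀ z ∈ B i, ∀ z' ∈ B j, δ ≤ dist z z'

/-- The orbit of `z` under `F` follows the itinerary `x`. -/
def Follows {ι : Type*} (F : ℂ → ℂ) (P : ι → ι → Set ℂ) (x : ℕ → ι) (z : ℂ) : Prop :=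
  ∀ n, F^[n] z ∈ P (x n) (x (n + 1))

namespace IsMarkovSystem

variable {ι : Type*} {F : ℂ → ℂ} {B : ι → Set ℂ} {P : ι → ι → Set ℂ} {L : ι → ℝ} {δ : ℝ}

theorem exists_follows_finite (h : IsMarkovSystem F B P L δ) (n : ℕ) (x : ℕ → ι) :
    ∀ w ∈ B (x n), ∃ z ∈ B (x 0), F^[n] z = w ∧ ∀ j < n, F^[j] z ∈ P (x j) (x (j + 1)) := by
  induction n generalizing x with
  | zero => exact fun w hw => ⟨w, hw, rfl, by simp⟩
  | succ n ih =>
    intro w hw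
    obtain ⟨z', hz', hw', hj⟩ := ih (fun k => x (k + 1)) w hw
    obtain ⟨z, hz, rfl⟩ := h.surj (x 0) (x 1) hz'
    refine ⟨z, h.subset _ _ hz, hw', fun j hj' => ?_⟩
    cases j with
    | zero => exact hz
    | succ j => exact hj j (by omega)

/-- Points realizing longer and longer finite itineraries have, by compactness of the pieces, limits
along an ultrafilter at every time `j` simultaneously; continuity of `F` on the pieces makes these
limits a single orbit. -/
theorem exists_follows (h : IsMarkovSystem F B P L δ) (x : ℕ → ι) : ∃ z, Follows F P x z := by
  have H : ∀ n, ∃ z, ∀ j < n, F^[j] z ∈ P (x j) (x (j + 1)) := fun n => by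
    obtain ⟨w, hw⟩ := h.nonempty (x n)
    obtain ⟨z, _, _, hz⟩ := h.exists_follows_finite n x w hw
    exact ⟨z, hz⟩
  choose z hz using H
  let U : Ultrafilter ℕ := hyperfilter ℕ
  have hU : ∀ j, ∀ᶠ n in (U : Filter ℕ), F^[j] (z n) ∈ P (x j) (x (j + 1)) := fun j =>
    Filter.Eventually.filter_mono Nat.hyperfilter_le_atTop
      ((eventually_gt_atTop j).mono fun n hn => hz n j hn)
  have H : ∀ j, ∃ w ∈ P (x j) (x (j + 1)), Tendsto (fun n => F^[j] (z n)) U (𝓝 w) := fun j =>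
    (h.compact _ _).ultrafilter_le_nhds (U.map fun n => F^[j] (z n)) (le_principal_iff.2 (hU j))
  choose w hw hlim using H
  have hF : ∀ j, F (w j) = w (j + 1) := fun j => by
    have h1 := (h.cont _ _ _ (hw j)).tendsto.comp (hlim j)
    refine tendsto_nhds_unique h1 ?_
    simpa only [Function.comp_def, ← Function.iterate_succ_apply'] using hlim (j + 1)
  have hit : ∀ j, F^[j] (w 0) = w j := fun j => by
    induction j with
    | zero => rfl
    | succ j ih => rw [Function.iterate_succ_apply', ih, hF]
  exact ⟨w 0, fun n => by rw [hit]; exact hw n⟩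

theorem expand_iterate (h : IsMarkovSystem F B P L δ) {x x' : ℕ → ι} {z z' : ℂ}
    (hz : Follows F P x z) (hz' : Follows F P x' z') {j k : ℕ}
    (hx : ∀ i ≤ j + k, x i = x' i) :
    2 ^ k * dist (F^[j] z) (F^[j] z') ≤ dist (F^[j + k] z) (F^[j + k] z') := by
  induction k with
  | zero => simp
  | succ k ih =>
    have h1 := ih fun i hi => hx i (by omega)
    have h2 := h.expand _ _ _ (hz (j + k)) (F^[j + k] z') (by
      rw [hx (j + k) (by omega), hx (j + k + 1) (by omega)]
      exact hz' (j + k))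
    rw [← Function.iterate_succ_apply' F, ← Function.iterate_succ_apply' F] at h2
    rw [pow_succ, ← add_assoc]
    linarith

theorem lip_iterate (h : IsMarkovSystem F B P L δ) (hL : ∀ i, 1 < L i) {x x' : ℕ → ι} {z z' : ℂ}
    (hz : Follows F P x z) (hz' : Follows F P x' z') {k : ℕ} (hx : ∀ i ≤ k, x i = x' i) :
    dist (F^[k] z) (F^[k] z') ≤ (∏ j ∈ Finset.range k, L (x (j + 1))) * dist z z' := by
  induction k with
  | zero => simp
  | succ k ih =>
    have h1 := ih fun i hi => hx i (by omega)
    have h2 := h.lip _ _ _ (hz k) (F^[k] z') (by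
      rw [hx k (by omega), hx (k + 1) (by omega)]
      exact hz' k)
    rw [← Function.iterate_succ_apply' F, ← Function.iterate_succ_apply' F] at h2
    rw [Finset.prod_range_succ, mul_assoc, mul_left_comm]
    exact h2.trans (mul_le_mul_of_nonneg_left h1 (by linarith [hL (x (k + 1))]))

/-- Two orbits share a piece only while two consecutive symbols agree, so the distortion estimates
stop one step before the first differing symbol. Uniform continuity on the compact union of the
pieces carries the separation `δ` back by that step; for `m = 0` the truncated `m - 1` is harmless.
-/
theorem exists_dist_lower_bound [Finite ι] (h : IsMarkovSystem F B P L δ) :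
    ∃ η > 0, ∀ x x' z z', Follows F P x z → Follows F P x' z' → ∀ m,
      x m ≠ x' m → η ≤ dist (F^[m - 1] z) (F^[m - 1] z') := by
  have hc : IsCompact (⋃ i, ⋃ j, P i j) :=
    isCompact_iUnion fun i => isCompact_iUnion fun j => h.compact i j
  have hu := hc.uniformContinuousOn_of_continuous (f := F) (by
    intro z hz
    simp only [mem_iUnion] at hz
    obtain ⟨i, j, hz⟩ := hz
    exact (h.cont i j z hz).continuousWithinAt)
  obtain ⟨η, hη, H⟩ := Metric.uniformContinuousOn_iff.1 hu δ h.pos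
  refine ⟨min η δ, lt_min hη h.pos, fun x x' z z' hz hz' m hm => ?_⟩
  have hB : δ ≤ dist (F^[m] z) (F^[m] z') :=
    h.sep _ _ hm _ (h.subset _ _ (hz m)) _ (h.subset _ _ (hz' m))
  cases m with
  | zero => exact (min_le_right _ _).trans hB
  | succ m =>
    refine (min_le_left _ _).trans (not_lt.1 fun hlt => ?_)
    have := H _ (mem_iUnion₂.2 ⟨_, _, hz m⟩) _ (mem_iUnion₂.2 ⟨_, _, hz' m⟩) (by simpa using hlt)
    rw [Function.iterate_succ_apply', Function.iterate_succ_apply'] at hB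
    linarith

/-- The limit set has dimension at least `t` if `∑ (L i)⁻ᵗ ≥ 1`. -/
theorem le_dimH [Fintype ι] (h : IsMarkovSystem F B P L δ) (hL : ∀ i, 1 < L i) (t : NNReal)
    (ht : 0 < t) (hsum : 1 ≤ ∑ i, L i ^ (-(t : ℝ))) :
    (t : ENNReal) ≤ dimH {z | ∃ x, Follows F P x z} := by
  choose π hπ using h.exists_follows
  have hL0 : ∀ i, 0 < L i := fun i => one_pos.trans (hL i)
  have hc : ∀ i, 0 < L i ^ (-(t : ℝ)) := fun i => Real.rpow_pos_of_pos (hL0 i) _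
  have hc1 : ∀ i, L i ^ (-(t : ℝ)) < 1 := fun i =>
    Real.rpow_lt_one_of_one_lt_of_neg (hL i) (by simpa using ht)
  set S := ∑ i, L i ^ (-(t : ℝ)) with hS
  have hS0 : 0 < S := by linarith
  have hle : ∀ i, L i ^ (-(t : ℝ)) / S ≤ L i ^ (-(t : ℝ)) := fun i => div_le_self (hc i).le hsum
  obtain ⟨η, hη, H⟩ := h.exists_dist_lower_bound
  let C : NNReal := ⟨(η⁻¹) ^ (t : ℝ), by positivity⟩
  have := le_dimH_of_coding (fun i => L i ^ (-(t : ℝ)) / S) (fun i => div_pos (hc i) hS0)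
    (fun i => (hle i).trans_lt (hc1 i)) (by rw [← Finset.sum_div, div_self hS0.ne']) t C ht π
    (by
      intro x x' m hx hm
      have h1 := H x x' _ _ (hπ x) (hπ x') m hm
      cases m with
      | zero =>
        simp only [Finset.range_zero, Finset.prod_empty]
        change 1 ≤ (η⁻¹) ^ (t : ℝ) * _
        rw [← Real.mul_rpow (by positivity) dist_nonneg]
        refine Real.one_le_rpow ?_ t.2
        rw [← div_eq_inv_mul, one_le_div hη]
        exact h1
      | succ m =>
        have h2 := h.lip_iterate hL (hπ x) (hπ x') (k := m) fun i hi => hx i (by omega)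
        set d := dist (π x) (π x')
        set Q := ∏ j ∈ Finset.range m, L (x (j + 1))
        have hQ : 0 < Q := Finset.prod_pos fun j _ => hL0 _
        have h3 : Q⁻¹ ≤ η⁻¹ * d := by
          rw [← div_eq_inv_mul, le_div_iff₀ hη, ← div_eq_inv_mul, div_le_iff₀ hQ, mul_comm]
          exact h1.trans h2
        change _ ≤ (η⁻¹) ^ (t : ℝ) * _
        rw [← Real.mul_rpow (by positivity) dist_nonneg]
        refine le_trans ?_ (Real.rpow_le_rpow (by positivity) h3 t.2)
        -- The Lipschitz factors belong to the targets `x 1, …, x m`. The weight of `x 0` has no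
        -- counterpart and is bounded by `1`.
        rw [Finset.prod_range_succ', ← Real.rpow_neg_eq_inv_rpow,
          ← Real.finsetProd_rpow _ _ fun j _ => (hL0 _).le]
        calc _ ≤ (∏ j ∈ Finset.range m, L (x (j + 1)) ^ (-(t : ℝ))) * 1 := by
              refine mul_le_mul ?_ ((hle _).trans (hc1 _).le) (div_pos (hc _) hS0).le
                (Finset.prod_nonneg fun j _ => (hc _).le)
              exact Finset.prod_le_prod (fun j _ => (div_pos (hc _) hS0).le) fun j _ => hle _
          _ = _ := mul_one _)
  refine this.trans (dimH_mono ?_)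
  rintro _ ⟨x, rfl⟩
  exact ⟨x, hπ x⟩

/-- Arbitrarily close to a point of the limit set there are points of the limit set whose orbits
separate from its orbit at a prescribed late time, but not earlier. -/
theorem exists_dist_iterate [Nontrivial ι] (h : IsMarkovSystem F B P L δ)
    {x : ℕ → ι} {z : ℂ} (hz : Follows F P x z) {V : Set ℂ} (hV : V ∈ 𝓝 z) (n₀ : ℕ) {ε : ℝ}
    (hε : 0 < ε) :
    ∃ N, ∀ n ≥ N, ∃ x' z', Follows F P x' z' ∧ z' ∈ V ∧ δ ≤ dist (F^[n] z) (F^[n] z') ∧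
      dist (F^[n₀] z) (F^[n₀] z') < ε := by
  obtain ⟨M, hM⟩ := h.bounded
  obtain ⟨r, hr, hrV⟩ := Metric.mem_nhds_iff.1 hV
  have hlim : Tendsto (fun k : ℕ => (2 : ℝ) ^ k) atTop atTop :=
    tendsto_pow_atTop_atTop_of_one_lt (by norm_num)
  obtain ⟨N, hN⟩ := eventually_atTop.1 (hlim.eventually_gt_atTop (2 * M / min r ε))
  refine ⟨N + n₀ + 1, fun n hn => ?_⟩
  -- Changing the itinerary at the single place `n` forces separation at time `n`, whereas expansion
  -- up to time `n - 1` within a bounded set makes the orbits close at all times up to `n₀`.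
  obtain ⟨i, hi⟩ := exists_ne (x n)
  obtain ⟨z', hz'⟩ := h.exists_follows (Function.update x n i)
  have hne : ∀ j < n, x j = Function.update x n i j := fun j hj => by
    rw [Function.update_of_ne hj.ne]
  have key : ∀ j ≤ n₀, dist (F^[j] z) (F^[j] z') < min r ε := fun j hj => by
    have h1 := h.expand_iterate hz hz' (j := j) (k := n - 1 - j) fun l hl => hne l (by omega)
    have h2 : dist (F^[j + (n - 1 - j)] z) (F^[j + (n - 1 - j)] z') ≤ 2 * M := by
      refine (dist_le_norm_add_norm _ _).trans ?_
      linarith [hM _ _ (h.subset _ _ (hz (j + (n - 1 - j)))),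
        hM _ _ (h.subset _ _ (hz' (j + (n - 1 - j))))]
    have h3 := hN (n - 1 - j) (by omega)
    have hmin : 0 < min r ε := lt_min hr hε
    rw [div_lt_iff₀ hmin] at h3
    have h4 : (0 : ℝ) < 2 ^ (n - 1 - j) := by positivity
    exact lt_of_mul_lt_mul_left ((h1.trans h2).trans_lt h3) h4.le
  refine ⟨_, z', hz', hrV ?_, ?_, (key n₀ le_rfl).trans_le (min_le_right _ _)⟩
  · rw [Metric.mem_ball, dist_comm]
    exact (key 0 (Nat.zero_le _)).trans_le (min_le_left _ _)
  · refine h.sep _ _ ?_ _ (h.subset _ _ (hz n)) _ (h.subset _ _ (hz' n))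
    rw [Function.update_self]
    exact hi.symm

end IsMarkovSystem

/-! ### The chordal metric, and limit sets inside Julia sets -/

/-- On bounded sets, points that are close in the chordal metric are close in the plane. -/
theorem exists_chordalDist_bound (M : ℝ) (hM : 0 ≤ M) {η : ℝ} (hη : 0 < η) :
    ∃ ε > 0, ∀ x : ℂ, ‖x‖ ≤ M → ∀ G : OnePoint ℂ, chordalDist x G < ε →
      ∃ y : ℂ, G = y ∧ dist x y < η := by
  -- With `d = ‖x - y‖`, closeness gives `2 d < ε (1 + M) (1 + M + d) ≤ η + d`. The first bound on
  -- `ε` also excludes `∞`.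
  refine ⟨min (1 / (1 + M)) (η / (1 + M) ^ 2), by positivity, fun x hx G hG => ?_⟩
  have hsq : ∀ w : ℂ, √(1 + ‖w‖ ^ 2) ≤ 1 + ‖w‖ := fun w =>
    Real.sqrt_le_iff.2 ⟨by positivity, by nlinarith [norm_nonneg w]⟩
  have hpos : ∀ w : ℂ, 0 < √(1 + ‖w‖ ^ 2) := fun w => by positivity
  have hxM : √(1 + ‖x‖ ^ 2) ≤ 1 + M := (hsq x).trans (by linarith)
  have hM1 : 0 < 1 + M := by linarith
  induction G using OnePoint.rec with
  | infty =>
    exfalso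
    have h1 : 2 / √(1 + ‖x‖ ^ 2) < 1 / (1 + M) := hG.trans_le (min_le_left _ _)
    rw [div_lt_div_iff₀ (hpos x) hM1] at h1
    linarith
  | coe y =>
    refine ⟨y, rfl, ?_⟩
    have hG' : 2 * ‖x - y‖ / (√(1 + ‖x‖ ^ 2) * √(1 + ‖y‖ ^ 2)) <
      min (1 / (1 + M)) (η / (1 + M) ^ 2) := hG
    set ε := min (1 / (1 + M)) (η / (1 + M) ^ 2) with hε
    have hε0 : 0 < ε := by positivity
    rw [div_lt_iff₀ (mul_pos (hpos x) (hpos y))] at hG'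
    have hy : √(1 + ‖y‖ ^ 2) ≤ 1 + M + ‖x - y‖ := by
      have := norm_sub_norm_le y x
      rw [norm_sub_rev] at this
      linarith [hsq y]
    have h2 : √(1 + ‖x‖ ^ 2) * √(1 + ‖y‖ ^ 2) ≤ (1 + M) * (1 + M + ‖x - y‖) :=
      mul_le_mul hxM hy (hpos y).le hM1.le
    have h3 := mul_le_mul_of_nonneg_left h2 hε0.le
    have h4 : ε * (1 + M) ≤ 1 := by
      rw [← le_div_iff₀ hM1]
      exact min_le_left _ _
    have h5 : ε * (1 + M) ^ 2 ≤ η := by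
      rw [← le_div_iff₀ (by positivity)]
      exact min_le_right _ _
    rw [dist_eq_norm]
    nlinarith [norm_nonneg (x - y)]

theorem chordalDist_self (z : OnePoint ℂ) : chordalDist z z = 0 := by
  induction z using OnePoint.rec <;> simp [chordalDist]

theorem chordalDist_comm (z w : OnePoint ℂ) : chordalDist z w = chordalDist w z := by
  induction z using OnePoint.rec <;> induction w using OnePoint.rec <;>
    simp [chordalDist, norm_sub_rev, mul_comm]

theorem toSphere_of_analyticAt {f : ℂ → ℂ} {z : ℂ} (h : AnalyticAt ℂ f z) :
    toSphere f z = f z := by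
  rw [toSphere, if_neg]
  rintro ⟨m, hm, h'⟩
  have := h.meromorphicOrderAt_nonneg
  rw [h'] at this
  norm_cast at this
  omega

/-- A finite spherical value excludes a pole, and normal form then excludes a removable singularity
with a wrong value. -/
theorem analyticAt_of_toSphere {f : ℂ → ℂ} (hf : IsMeromorphicFun f) {z w : ℂ}
    (h : toSphere f z = w) : AnalyticAt ℂ f z ∧ f z = w := by
  rw [toSphere] at h
  split_ifs at h with hp
  · exact absurd h (OnePoint.infty_ne_coe w)
  · refine ⟨(hf (mem_univ z)).meromorphicOrderAt_nonneg_iff_analyticAt.1 ?_,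
      OnePoint.coe_injective h⟩
    by_contra hlt
    rw [not_le] at hlt
    obtain ⟨n, hn⟩ := WithTop.ne_top_iff_exists.1 hlt.ne_top
    rw [← hn] at hlt
    have hn0 : n < 0 := by exact_mod_cast hlt
    refine hp ⟨n.natAbs, by omega, ?_⟩
    rw [← hn, Int.natCast_natAbs, abs_of_neg hn0, neg_neg]

theorem iter_eq_of_follows {ι : Type*} {f : ℂ → ℂ} {P : ι → ι → Set ℂ}
    (ha : ∀ i j, ∀ z ∈ P i j, AnalyticAt ℂ f z) {x : ℕ → ι} {z : ℂ} (hz : Follows f P x z)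
    (k : ℕ) : iter f k z = (f^[k] z : ℂ) := by
  induction k with
  | zero => rfl
  | succ k ih =>
    rw [iter, ih, Function.iterate_succ_apply']
    exact toSphere_of_analyticAt (ha _ _ _ (hz k))

/-- The limit set of a Markov system is contained in the Julia set. -/
theorem IsMarkovSystem.notMem_fatouSet {ι : Type*} [Nontrivial ι] {f : ℂ → ℂ} {B : ι → Set ℂ}
    {P : ι → ι → Set ℂ} {L : ι → ℝ} {δ : ℝ} (h : IsMarkovSystem f B P L δ)
    (ha : ∀ i j, ∀ z ∈ P i j, AnalyticAt ℂ f z) {x : ℕ → ι} {z : ℂ} (hz : Follows f P x z) :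
    z ∉ fatouSet f := by
  rintro ⟨U, hU, hzU, -, hN⟩
  obtain ⟨φ, hφ, g, hg⟩ := hN (iter f) fun n => mem_range_self n
  obtain ⟨r, hr, hrU⟩ := Metric.nhds_basis_closedBall.mem_iff.1 (hU.mem_nhds hzU)
  obtain ⟨M, hM⟩ := h.bounded
  have hM' : ∀ x z, Follows f P x z → ∀ n, ‖f^[n] z‖ ≤ max M 0 := fun x z hz n =>
    (hM _ _ (h.subset _ _ (hz n))).trans (le_max_left _ _)
  have hδ := h.pos
  obtain ⟨ε, hε, H⟩ := exists_chordalDist_bound (max M 0) (le_max_right _ _)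
    (η := δ / 8) (by positivity)
  obtain ⟨k₀, hk₀⟩ := eventually_atTop.1 (hg _ hrU (isCompact_closedBall z r) ε hε)
  -- Both iterates are compared with the unknown limit `g z'`, each to within `δ / 8`.
  have close : ∀ x' z', Follows f P x' z' → z' ∈ Metric.closedBall z r → ∀ k ≥ k₀,
      dist (f^[φ k] z') (f^[φ k₀] z') < δ / 4 := by
    intro x' z' hz' hr' k hk
    have h1 := hk₀ k hk z' hr'
    have h2 := hk₀ k₀ le_rfl z' hr'
    simp only [iter_eq_of_follows ha hz'] at h1 h2
    obtain ⟨y, hy, h3⟩ := H _ (hM' _ _ hz' _) _ h1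
    obtain ⟨y', hy', h4⟩ := H _ (hM' _ _ hz' _) _ h2
    obtain rfl : y = y' := OnePoint.coe_injective (hy.symm.trans hy')
    linarith [dist_triangle_right (f^[φ k] z') (f^[φ k₀] z') y]
  obtain ⟨N, hN⟩ := h.exists_dist_iterate hz (Metric.closedBall_mem_nhds z hr) (φ k₀)
    (ε := δ / 4) (by positivity)
  -- At this late time the orbits are `δ` apart, yet passing through time `φ k₀` bounds their
  -- distance by `3 δ / 4`.
  obtain ⟨x', z', hz', hV, h1, h2⟩ := hN (φ (max N k₀)) ((le_max_left _ _).trans (hφ.id_le _))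
  have h3 := close x z hz (Metric.mem_closedBall_self hr.le) _ (le_max_right N k₀)
  have h4 := close x' z' hz' hV _ (le_max_right N k₀)
  have h5 := dist_triangle4 (f^[φ (max N k₀)] z) (f^[φ k₀] z) (f^[φ k₀] z') (f^[φ (max N k₀)] z')
  rw [dist_comm (f^[φ k₀] z')] at h5
  linarith

/-- The limit set of a Markov system bounds the dimension of the Julia set from below. -/
theorem IsMarkovSystem.le_sphereDim {ι : Type*} [Fintype ι] [Nontrivial ι] {f : ℂ → ℂ}
    {B : ι → Set ℂ} {P : ι → ι → Set ℂ} {L : ι → ℝ} {δ : ℝ} (h : IsMarkovSystem f B P L δ)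
    (ha : ∀ i j, ∀ z ∈ P i j, AnalyticAt ℂ f z) (hL : ∀ i, 1 < L i) (t : NNReal)
    (ht : 0 < t) (hsum : 1 ≤ ∑ i, L i ^ (-(t : ℝ))) :
    (t : ENNReal) ≤ sphereDim (juliaSet f) := by
  refine (h.le_dimH hL t ht hsum).trans (dimH_mono ?_)
  rintro z ⟨x, hz⟩
  simp only [juliaSet, mem_preimage, mem_compl_iff, mem_image, OnePoint.coe_eq_coe,
    exists_eq_right]
  exact h.notMem_fatouSet ha hz

/-! ### Persistence of almost affine discs under perturbation -/

/-- Spherically locally uniform convergence to a finite-valued limit is Euclidean uniform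
convergence of functions that are eventually analytic. -/
theorem TendstoLocUnif.tendstoUniformlyOn {f : ℂ → ℂ} {F : ℕ → ℂ → ℂ}
    (hF : ∀ n, IsMeromorphicFun (F n))
    (hlim : TendstoLocUnif (fun n => toSphere (F n)) (toSphere f) univ) {K : Set ℂ}
    (hK : IsCompact K) (hf : AnalyticOnNhd ℂ f K) :
    TendstoUniformlyOn F f atTop K ∧ ∀ᶠ n in atTop, AnalyticOnNhd ℂ (F n) K := by
  obtain ⟨M, hM⟩ := hK.exists_bound_of_continuousOn hf.continuousOn
  have key : ∀ η > 0, ∀ᶠ n in atTop, ∀ z ∈ K, AnalyticAt ℂ (F n) z ∧ dist (f z) (F n z) < η := by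
    intro η hη
    obtain ⟨ε, hε, H⟩ := exists_chordalDist_bound (max M 0) (le_max_right _ _) hη
    filter_upwards [hlim K (subset_univ _) hK ε hε] with n hn z hz
    have h1 := hn z hz
    rw [chordalDist_comm, toSphere_of_analyticAt (hf z hz)] at h1
    obtain ⟨y, hy, h2⟩ := H _ ((hM z hz).trans (le_max_left _ _)) _ h1
    obtain ⟨h3, h4⟩ := analyticAt_of_toSphere (hF n) hy
    exact ⟨h3, h4 ▸ h2⟩
  exact ⟨Metric.tendstoUniformlyOn_iff.2 fun η hη => (key η hη).mono fun n hn z hz => (hn z hz).2,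
    (key 1 one_pos).mono fun n hn z hz => (hn z hz).1⟩

/-- A function whose derivative on a disc is close to the constant `A` is close to affine. -/
theorem approx_of_deriv {f : ℂ → ℂ} {ξ A : ℂ} {ρ c : ℝ}
    (hf : AnalyticOnNhd ℂ f (Metric.closedBall ξ ρ))
    (hd : ∀ z ∈ Metric.closedBall ξ ρ, ‖deriv f z - A‖ ≤ c) :
    ∀ z ∈ Metric.closedBall ξ ρ, ∀ z' ∈ Metric.closedBall ξ ρ,
      ‖f z - f z' - A * (z - z')‖ ≤ c * ‖z - z'‖ := by
  intro z hz z' hz'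
  have := (convex_closedBall ξ ρ).norm_image_sub_le_of_norm_hasDerivWithin_le
    (f := fun w => f w - A * w) (f' := fun w => deriv f w - A) (C := c) (fun w hw =>
      ((hf w hw).differentiableAt.hasDerivAt.sub
        (by simpa using (hasDerivAt_id w).const_mul A)).hasDerivWithinAt) hd hz' hz
  rw [show f z - f z' - A * (z - z') = f z - A * z - (f z' - A * z') by ring]
  exact this

/-- Division by `A` is a right inverse of the linear part with norm `‖A‖⁻¹`, so the quantitative
inverse function argument applies. -/
theorem surjOn_of_approx {f : ℂ → ℂ} {ξ A : ℂ} {ρ : ℝ} {c : NNReal} (hρ : 0 ≤ ρ) (hA : A ≠ 0)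
    (h : ∀ z ∈ Metric.closedBall ξ ρ, ∀ z' ∈ Metric.closedBall ξ ρ,
      ‖f z - f z' - A * (z - z')‖ ≤ c * ‖z - z'‖) :
    SurjOn f (Metric.closedBall ξ ρ) (Metric.closedBall (f ξ) ((‖A‖ - c) * ρ)) := by
  have h' : ApproximatesLinearOn f (A • ContinuousLinearMap.id ℂ ℂ) (Metric.closedBall ξ ρ) c :=
    fun z hz z' hz' => by simpa using h z hz z' hz'
  let R : (A • ContinuousLinearMap.id ℂ ℂ).NonlinearRightInverse :=
    { toFun := fun y => A⁻¹ * y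
      nnnorm := ‖A⁻¹‖₊
      bound' := fun y => by simp
      right_inv' := fun y => by simp [hA] }
  have := h'.surjOn_closedBall_of_nonlinearRightInverse R hρ subset_rfl
  simpa [R] using this

/-- Perturbation of an almost affine disc. -/
theorem eventually_disc {f : ℂ → ℂ} {F : ℕ → ℂ → ℂ} (hF : ∀ n, IsMeromorphicFun (F n))
    (hlim : TendstoLocUnif (fun n => toSphere (F n)) (toSphere f) univ) {ξ A b : ℂ} {ρ ε : ℝ}
    (hρ : 0 < ρ) (hε : 0 < ε) (hf : AnalyticOnNhd ℂ f (Metric.closedBall ξ (2 * ρ)))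
    (hd : ∀ z ∈ Metric.closedBall ξ ρ, ‖deriv f z - A‖ ≤ 1 / 2 * ‖A‖) (hb : f ξ = b)
    (hA : 10 * ε ≤ ‖A‖ * ρ) :
    ∀ᶠ n in atTop, AnalyticOnNhd ℂ (F n) (Metric.closedBall ξ ρ) ∧
      SurjOn (F n) (Metric.closedBall ξ ρ) (Metric.closedBall b ε) ∧
      ∀ z ∈ Metric.closedBall ξ ρ, ∀ z' ∈ Metric.closedBall ξ ρ,
        dist (F n z) (F n z') ≤ 2 * ‖A‖ * dist z z' ∧
        2 / 5 * ‖A‖ * dist z z' ≤ dist (F n z) (F n z') := by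
  have hA0 : 0 < ‖A‖ := by
    by_contra h
    have : ‖A‖ = 0 := le_antisymm (not_lt.1 h) (norm_nonneg _)
    rw [this] at hA
    linarith
  obtain ⟨h1, h2⟩ := hlim.tendstoUniformlyOn hF (isCompact_closedBall _ _) hf
  have hss : Metric.closedBall ξ ρ ⊆ Metric.ball ξ (2 * ρ) :=
    Metric.closedBall_subset_ball (by linarith)
  have h3 : TendstoLocallyUniformlyOn (deriv ∘ F) (deriv f) atTop (Metric.ball ξ (2 * ρ)) :=
    (h1.mono Metric.ball_subset_closedBall).tendstoLocallyUniformlyOn.deriv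
      (h2.mono fun n hn => (hn.mono Metric.ball_subset_closedBall).differentiableOn)
      Metric.isOpen_ball
  have h4 := (tendstoLocallyUniformlyOn_iff_forall_isCompact Metric.isOpen_ball).1 h3 _ hss
    (isCompact_closedBall _ _)
  filter_upwards [h2, Metric.tendstoUniformlyOn_iff.1 h4 (1 / 10 * ‖A‖) (by positivity),
    Metric.tendstoUniformlyOn_iff.1 h1 ε hε] with n hn hn' hn''
  have ha := hn.mono (hss.trans Metric.ball_subset_closedBall)
  -- The errors `1/2` and `1/10` add up to `3/5`. This leaves expansion at least `2/5 ‖A‖` and an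
  -- image disc of radius `2/5 ‖A‖ ρ ≥ 4 ε`, which absorbs the displacement of the centre by less
  -- than `ε`.
  have happ := approx_of_deriv (A := A) (c := 3 / 5 * ‖A‖) ha fun z hz => by
    have := hn' z hz
    rw [dist_comm, dist_eq_norm, Function.comp_apply] at this
    have h5 := norm_sub_le_norm_sub_add_norm_sub (deriv (F n) z) (deriv f z) A
    linarith [hd z hz]
  refine ⟨ha, ?_, fun z hz z' hz' => ?_⟩
  · have := surjOn_of_approx (c := ⟨3 / 5 * ‖A‖, by positivity⟩) hρ.le (norm_pos_iff.1 hA0) happ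
    refine this.mono subset_rfl (Metric.closedBall_subset_closedBall' ?_)
    have h6 := hn'' ξ (Metric.mem_closedBall_self (by linarith))
    rw [hb] at h6
    change _ ≤ (‖A‖ - 3 / 5 * ‖A‖) * ρ
    linarith
  · have h7 := happ z hz z' hz'
    have h8 : ‖A * (z - z')‖ = ‖A‖ * ‖z - z'‖ := norm_mul _ _
    have h9 := norm_sub_norm_le (A * (z - z')) (F n z - F n z')
    have h10 := norm_sub_norm_le (F n z - F n z') (A * (z - z'))
    rw [norm_sub_rev (A * (z - z'))] at h9
    rw [dist_eq_norm, dist_eq_norm]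
    constructor <;> nlinarith [norm_nonneg (z - z')]

/-- A finite system of almost affine discs persists under perturbation as a Markov system. -/
theorem eventually_isMarkovSystem {ι : Type*} [Finite ι] {f : ℂ → ℂ} {F : ℕ → ℂ → ℂ}
    (hF : ∀ n, IsMeromorphicFun (F n))
    (hlim : TendstoLocUnif (fun n => toSphere (F n)) (toSphere f) univ) {b : ι → ℂ}
    {ξ : ι → ι → ℂ} {A : ι → ℂ} {ρ : ι → ℝ} {ε : ℝ} (hε : 0 < ε)
    (hsep : ∀ i j, i ≠ j → 3 * ε ≤ dist (b i) (b j)) (hρ : ∀ j, 0 < ρ j)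
    (hsub : ∀ i j, Metric.closedBall (ξ i j) (ρ j) ⊆ Metric.closedBall (b i) ε)
    (hf : ∀ i j, AnalyticOnNhd ℂ f (Metric.closedBall (ξ i j) (2 * ρ j)))
    (hd : ∀ i j, ∀ z ∈ Metric.closedBall (ξ i j) (ρ j), ‖deriv f z - A j‖ ≤ 1 / 2 * ‖A j‖)
    (hb : ∀ i j, f (ξ i j) = b j) (hA : ∀ j, 10 * ε ≤ ‖A j‖ * ρ j) (hA5 : ∀ j, 5 ≤ ‖A j‖) :
    ∀ᶠ n in atTop, ∃ P : ι → ι → Set ℂ, (∀ i j, ∀ z ∈ P i j, AnalyticAt ℂ (F n) z) ∧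
      IsMarkovSystem (F n) (fun i => Metric.closedBall (b i) ε) P (fun j => 2 * ‖A j‖) ε := by
  have H := eventually_all.2 fun i => eventually_all.2 fun j =>
    eventually_disc hF hlim (hρ j) hε (hf i j) (hd i j) (hb i j) (hA j)
  filter_upwards [H] with n hn
  refine ⟨fun i j => Metric.closedBall (ξ i j) (ρ j) ∩ F n ⁻¹' Metric.closedBall (b j) ε,
    fun i j z hz => (hn i j).1 z hz.1, ?_⟩
  refine
    { nonempty := fun i => ⟨b i, Metric.mem_closedBall_self hε.le⟩
      bounded := ?_
      subset := fun i j => inter_subset_left.trans (hsub i j)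
      compact := fun i j => ?_
      cont := fun i j z hz => ((hn i j).1 z hz.1).continuousAt
      surj := fun i j w hw => ?_
      lip := fun i j z hz z' hz' => ((hn i j).2.2 z hz.1 z' hz'.1).1
      expand := fun i j z hz z' hz' => ?_
      pos := hε
      sep := fun i j hij z hz z' hz' => ?_ }
  · obtain ⟨M, hM⟩ := 
      (isCompact_iUnion fun i => isCompact_closedBall (b i) ε).isBounded.exists_norm_le
    exact ⟨M, fun i z hz => hM z (mem_iUnion.2 ⟨i, hz⟩)⟩
  · exact (isCompact_closedBall _ _).of_isClosed_subset
      ((hn i j).1.continuousOn.preimage_isClosed_of_isClosed Metric.isClosed_closedBall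
        Metric.isClosed_closedBall) inter_subset_left
  · obtain ⟨z, hz, rfl⟩ := (hn i j).2.1 hw
    exact ⟨z, ⟨hz, hw⟩, rfl⟩
  · refine le_trans ?_ ((hn i j).2.2 z hz.1 z' hz'.1).2
    exact mul_le_mul_of_nonneg_right (by linarith [hA5 j]) dist_nonneg
  · have h1 := dist_triangle4 (b i) z z' (b j)
    rw [Metric.mem_closedBall] at hz hz'
    rw [dist_comm] at hz
    linarith [hsep i j hij]

/-! ### Local geometry at a pole -/

/-- Near a pole of multiplicity `q`, every value `b` of large modulus is taken at the centre of a
disc on which the function is almost affine, and whose image is large. -/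
theorem exists_disc_near_pole {f : ℂ → ℂ} {a : ℂ} {q : ℕ} (hp : HasPole f a q) {ε : ℝ}
    (hε : 0 < ε) :
    ∃ C > 0, ∃ R, ∀ b : ℂ, R ≤ ‖b‖ → ∃ ξ A : ℂ, ∃ ρ > 0,
      Metric.closedBall ξ (2 * ρ) ⊆ Metric.closedBall a ε ∧
      AnalyticOnNhd ℂ f (Metric.closedBall ξ (2 * ρ)) ∧
      (∀ z ∈ Metric.closedBall ξ ρ, ‖deriv f z - A‖ ≤ 1 / 2 * ‖A‖) ∧ f ξ = b ∧
      10 * ε ≤ ‖A‖ * ρ ∧ 5 ≤ ‖A‖ ∧ ‖A‖ ^ q ≤ C * ‖b‖ ^ (q + 1) := by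
  obtain ⟨hq, ho⟩ := hp
  have hmer : MeromorphicAt f a := by
    by_contra h
    rw [meromorphicOrderAt_of_not_meromorphicAt h] at ho
    norm_cast at ho
    omega
  obtain ⟨g, hg, hga, hfg⟩ := (meromorphicOrderAt_eq_int_iff hmer).1 ho
  -- If `f = (z - a)^(-q) g`, then `f' = (z - a)^(-(q+1)) h`, and `h a = -q g a` is nonzero.
  set h : ℂ → ℂ := fun z => -q * g z + (z - a) * deriv g z with hh
  have hha : h a ≠ 0 := by
    simp only [hh, sub_self, zero_mul, add_zero]
    exact mul_ne_zero (neg_ne_zero.2 (by exact_mod_cast (by omega : q ≠ 0))) hga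
  have hhc : ContinuousAt h a :=
    ((continuousAt_const.mul hg.continuousAt).add
      ((continuousAt_id.sub continuousAt_const).mul hg.deriv.continuousAt))
  -- local form of the function and of its derivative
  have hf1 : ∀ᶠ z in 𝓝[≠] a, f z = ((z - a) ^ q)⁻¹ * g z :=
    hfg.mono fun z hz => by rw [hz, smul_eq_mul, zpow_neg, zpow_natCast]
  have hf2 : ∀ᶠ z in 𝓝[≠] a, AnalyticAt ℂ f z ∧ deriv f z = ((z - a) ^ (q + 1))⁻¹ * h z := by
    filter_upwards [eventually_eventually_nhdsWithin.2 hf1, self_mem_nhdsWithin,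
      eventually_nhdsWithin_of_eventually_nhds hg.eventually_analyticAt] with z hz hza hgz
    have hza' : z - a ≠ 0 := sub_ne_zero.2 hza
    rw [IsOpen.nhdsWithin_eq isOpen_compl_singleton hza] at hz
    have hana : AnalyticAt ℂ (fun w => ((w - a) ^ q)⁻¹ * g w) z :=
      (((analyticAt_id.sub analyticAt_const).pow q).inv (pow_ne_zero _ hza')).mul hgz
    refine ⟨hana.congr (EventuallyEq.symm hz), ?_⟩
    rw [EventuallyEq.deriv_eq hz]
    have hd := (((((hasDerivAt_id z).sub_const a).pow q).inv (pow_ne_zero _ hza')).mul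
      hgz.differentiableAt.hasDerivAt).deriv
    refine Eq.trans hd ?_
    obtain ⟨k, rfl⟩ : ∃ k, q = k + 1 := ⟨q - 1, by omega⟩
    simp only [hh, id, Nat.add_sub_cancel, Pi.pow_apply, Pi.inv_apply, mul_one]
    field_simp
    push_cast
    ring
  -- With `u = ξ - a`, `τ = (z - ξ) / u` and `σ = h z / h a`, the expression is `f' z / A - 1` for
  -- the slope `A = u^(-(q+1)) h a`. The bound `κ ≤ 1/4` keeps the disc of radius `2 κ ‖u‖` about
  -- `ξ` away from the pole.
  obtain ⟨κ, hκ0, hκ1, hκ⟩ : ∃ κ > 0, κ ≤ (1 / 4 : ℝ) ∧ ∀ τ σ : ℂ, ‖τ‖ ≤ κ → ‖σ - 1‖ ≤ κ →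
      ‖((1 + τ) ^ (q + 1))⁻¹ * σ - 1‖ ≤ 1 / 2 := by
    have hc : ContinuousAt (fun p : ℂ × ℂ => ((1 + p.1) ^ (q + 1))⁻¹ * p.2 - 1) (0, 1) := by
      refine ((ContinuousAt.inv₀ (by fun_prop) (by simp)).mul (by fun_prop)).sub (by fun_prop)
    obtain ⟨κ, hκ, H⟩ := Metric.continuousAt_iff.1 hc (1 / 2) (by norm_num)
    refine ⟨min (κ / 2) (1 / 4), by positivity, min_le_right _ _, fun τ σ hτ hσ => ?_⟩
    have hle : min (κ / 2) (1 / 4) ≤ κ / 2 := min_le_left _ _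
    have := H (x := (τ, σ)) (by
      rw [Prod.dist_eq, dist_eq_norm, dist_eq_norm, sub_zero]
      exact max_lt (by linarith) (by linarith))
    simpa [dist_eq_norm] using this.le
  have hh3 : ∀ᶠ z in 𝓝 a, ‖h z / h a - 1‖ ≤ κ := by
    have : Tendsto (fun z => ‖h z / h a - 1‖) (𝓝 a) (𝓝 ‖h a / h a - 1‖) :=
      ((hhc.div_const _).sub continuousAt_const).norm
    rw [div_self hha, sub_self, norm_zero] at this
    exact this.eventually_le_const hκ0
  have hg4 : ∀ᶠ z in 𝓝 a, ‖g z‖ ≤ 2 * ‖g a‖ ∧ ‖g a‖ / 2 ≤ ‖g z‖ := by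
    have : 0 < ‖g a‖ := norm_pos_iff.2 hga
    exact (hg.continuousAt.norm.eventually_le_const (by linarith)).and
      (hg.continuousAt.norm.eventually_const_le (by linarith))
  obtain ⟨η₀, hη₀, H⟩ := Metric.eventually_nhds_iff_ball.1
    ((eventually_nhdsWithin_iff.1 hf1).and ((eventually_nhdsWithin_iff.1 hf2).and (hh3.and hg4)))
  obtain ⟨η, hη, hηε, hη1, hηη⟩ : ∃ η > 0, η ≤ ε ∧ η ≤ 1 ∧ η ≤ η₀ :=
    ⟨min ε (min 1 η₀), by positivity, min_le_left _ _, (min_le_right _ _).trans (min_le_left _ _),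
      (min_le_right _ _).trans (min_le_right _ _)⟩
  replace H : ∀ z, ‖z - a‖ < η → _ := fun z hz =>
    H z (by rw [Metric.mem_ball, dist_eq_norm]; linarith)
  -- large values are taken near the pole
  obtain ⟨r, hr, hbr⟩ : ∃ r > 0, ∀ w, ‖w‖ < r → ∃ ξ, ‖ξ - a‖ < η / 2 ∧ (ξ - a) ^ q / g ξ = w := by
    -- This is `1 / f` near `a`: it vanishes at `a` without being locally constant, so it is open
    -- there.
    have hk : AnalyticAt ℂ (fun z => (z - a) ^ q / g z) a :=
      ((analyticAt_id.sub analyticAt_const).pow q).div hg hga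
    have hk0 : (a - a) ^ q / g a = 0 := by
      rw [sub_self, zero_pow (by omega), zero_div]
    rcases hk.eventually_constant_or_nhds_le_map_nhds with hcon | hopen
    · exfalso
      have hne : ∀ᶠ z in 𝓝[≠] a, False := by
        filter_upwards [eventually_nhdsWithin_of_eventually_nhds hcon, self_mem_nhdsWithin,
          eventually_nhdsWithin_of_eventually_nhds (hg.continuousAt.eventually_ne hga)]
          with z hz hza hgz
        rw [hk0] at hz
        exact div_ne_zero (pow_ne_zero _ (sub_ne_zero.2 hza)) hgz hz
      exact hne.exists.elim fun _ h => h
    · rw [hk0] at hopen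
      have hmem := hopen (image_mem_map (Metric.ball_mem_nhds a (half_pos hη)))
      obtain ⟨r, hr, hsub⟩ := Metric.mem_nhds_iff.1 hmem
      refine ⟨r, hr, fun w hw => ?_⟩
      obtain ⟨ξ, hξ, h⟩ := hsub (mem_ball_zero_iff.2 hw)
      exact ⟨ξ, by rwa [Metric.mem_ball, dist_eq_norm] at hξ, h⟩
  have hGa : 0 < ‖g a‖ := norm_pos_iff.2 hga
  have hHa : 0 < ‖h a‖ := norm_pos_iff.2 hha
  set K := κ * ‖h a‖ / (2 * ‖g a‖) with hK
  have hK0 : 0 < K := by positivity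
  -- `C` comes from `‖u‖^(-q) ≤ 2 ‖b‖ / ‖g a‖`. The three lower bounds on `‖b‖` place `b⁻¹` in the
  -- image of `1 / f`, give `‖A‖ ρ ≥ 10 ε`, and give `‖A‖ ≥ 5` because `ρ ≤ 1`.
  refine ⟨(2 / ‖g a‖) ^ (q + 1) * ‖h a‖ ^ q, by positivity,
    max (1 / r + 1) (max (10 * ε / K) (5 / K)), fun b hb => ?_⟩
  have hb1 : 1 / r < ‖b‖ := by linarith [(le_max_left _ _).trans hb]
  have hb2 : 10 * ε ≤ K * ‖b‖ := by
    rw [mul_comm K, ← div_le_iff₀ hK0]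
    exact ((le_max_left _ _).trans (le_max_right _ _)).trans hb
  have hb3 : 5 ≤ K * ‖b‖ := by
    rw [mul_comm K, ← div_le_iff₀ hK0]
    exact ((le_max_right _ _).trans (le_max_right _ _)).trans hb
  have hb0 : 0 < ‖b‖ := (by positivity : 0 < 1 / r).trans hb1
  obtain ⟨ξ, hξ, hkξ⟩ := hbr b⁻¹ (by
    rw [norm_inv]
    exact inv_lt_of_inv_lt₀ hr (by rwa [← one_div]))
  have hξa : ξ ≠ a := by
    rintro rfl
    rw [sub_self, zero_pow (by omega), zero_div] at hkξ
    exact inv_ne_zero (norm_pos_iff.1 hb0) hkξ.symm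
  set u := ξ - a with hu
  have hu0 : 0 < ‖u‖ := norm_pos_iff.2 (sub_ne_zero.2 hξa)
  obtain ⟨hfξ, -, -, hg1, hg2⟩ := H ξ (by linarith)
  have hb' : f ξ = b := by
    rw [hfξ hξa, ← inv_inv b, ← hkξ, inv_div, div_eq_inv_mul]
  have hgξ : 0 < ‖g ξ‖ := by linarith
  have hnb : ‖b‖ = ‖g ξ‖ / ‖u‖ ^ q := by
    rw [← hb', hfξ hξa, norm_mul, norm_inv, norm_pow, div_eq_inv_mul]
  have hdisc : ∀ z ∈ Metric.closedBall ξ (2 * (κ * ‖u‖)), ‖z - a‖ < η ∧ z ≠ a := by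
    intro z hz
    rw [Metric.mem_closedBall, dist_eq_norm] at hz
    have h1 : 2 * (κ * ‖u‖) ≤ ‖u‖ / 2 := by nlinarith
    constructor
    · have h2 : ‖z - a‖ ≤ ‖z - ξ‖ + ‖u‖ := norm_sub_le_norm_sub_add_norm_sub z ξ a
      linarith
    · rintro rfl
      rw [norm_sub_rev] at hz
      linarith
  have hnA : ‖(u ^ (q + 1))⁻¹ * h a‖ = ‖h a‖ / ‖u‖ ^ (q + 1) := by
    rw [norm_mul, norm_inv, norm_pow, div_eq_inv_mul]
  have hAρ : K * ‖b‖ ≤ ‖(u ^ (q + 1))⁻¹ * h a‖ * (κ * ‖u‖) := by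
    have e : ‖(u ^ (q + 1))⁻¹ * h a‖ * (κ * ‖u‖) = κ * ‖h a‖ / ‖u‖ ^ q := by
      rw [hnA, pow_succ]
      field_simp
    have e' : K * ‖b‖ = κ * ‖h a‖ / ‖u‖ ^ q * (‖g ξ‖ / (2 * ‖g a‖)) := by
      rw [hnb, hK]
      field_simp
    rw [e, e']
    exact mul_le_of_le_one_right (by positivity) ((div_le_one (by positivity)).2 hg1)
  refine ⟨ξ, (u ^ (q + 1))⁻¹ * h a, κ * ‖u‖, by positivity, fun z hz => ?_, fun z hz => ?_,
    fun z hz => ?_, hb', hb2.trans hAρ, ?_, ?_⟩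
  · rw [Metric.mem_closedBall, dist_eq_norm]
    linarith [(hdisc z hz).1]
  · exact ((H z (hdisc z hz).1).2.1 (hdisc z hz).2).1
  · have hz' := hdisc z (Metric.closedBall_subset_closedBall (by nlinarith) hz)
    obtain ⟨-, hd, hz3, -⟩ := H z hz'.1
    have hu' : u ≠ 0 := norm_pos_iff.1 hu0
    have h1 := hκ ((z - ξ) / u) (h z / h a) (by
      rw [norm_div, div_le_iff₀ hu0, ← dist_eq_norm]
      exact hz) hz3
    have h2 : z - a = u * (1 + (z - ξ) / u) := by
      rw [mul_add, mul_div_cancel₀ _ hu', hu]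
      ring
    have h3 : deriv f z - (u ^ (q + 1))⁻¹ * h a =
        (((1 + (z - ξ) / u) ^ (q + 1))⁻¹ * (h z / h a) - 1) * ((u ^ (q + 1))⁻¹ * h a) := by
      rw [(hd hz'.2).2, h2, mul_pow, mul_inv]
      field_simp
    rw [h3, norm_mul]
    exact mul_le_mul_of_nonneg_right h1 (norm_nonneg _)
  · refine (hb3.trans hAρ).trans (mul_le_of_le_one_right (norm_nonneg _) ?_)
    nlinarith
  · have h1 : 1 / ‖u‖ ^ q ≤ 2 / ‖g a‖ * ‖b‖ := by
      rw [hnb, div_mul_div_comm, div_le_div_iff₀ (by positivity) (by positivity)]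
      have := pow_pos hu0 q
      nlinarith
    rw [hnA, div_pow, ← pow_mul, mul_comm (q + 1) q, pow_mul, div_eq_mul_inv]
    calc ‖h a‖ ^ q * ((‖u‖ ^ q) ^ (q + 1))⁻¹ = ‖h a‖ ^ q * (1 / ‖u‖ ^ q) ^ (q + 1) := by
          rw [one_div, inv_pow]
      _ ≤ ‖h a‖ ^ q * (2 / ‖g a‖ * ‖b‖) ^ (q + 1) := by gcongr
      _ = _ := by
          rw [mul_pow]
          ring

/-! ### Lattice sums and the critical exponent -/

/-- Lower bounds for lattice vectors. -/
theorem exists_lattice_bound {ω₁ ω₂ : ℂ} (h : LinearIndependent ℝ ![ω₁, ω₂]) :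
    ∃ c > 0, ∀ x y : ℝ, c * max |x| |y| ≤ ‖x * ω₁ + y * ω₂‖ := by
  obtain ⟨K, hK, hL⟩ := (Fintype.linearCombination ℝ ![ω₁, ω₂]).exists_antilipschitzWith
    (LinearMap.ker_eq_bot.2 h.fintypeLinearCombination_injective)
  refine ⟨(K : ℝ)⁻¹, by positivity, fun x y => ?_⟩
  have h1 := hL.le_mul_dist ![x, y] 0
  rw [map_zero, dist_zero_right, dist_zero_right] at h1
  simp only [Fintype.linearCombination_apply, Fin.sum_univ_two, Matrix.cons_val_zero,
    Matrix.cons_val_one, Complex.real_smul] at h1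
  rw [inv_mul_le_iff₀ (by exact_mod_cast hK)]
  refine le_trans (max_le ?_ ?_) h1
  · simpa using norm_le_pi_norm ![x, y] 0
  · simpa using norm_le_pi_norm ![x, y] 1

/-- Pairs `(k, n)` standing for the lattice points `(k + M) ω₁ + n ω₂` with `0 ≤ n < k + M`,
`k < N`. -/
def sector (M N : ℕ) : Finset (Σ _ : ℕ, ℕ) :=
  (Finset.range N).sigma fun k => Finset.range (k + M)

/-- Divergence of the sum of the squared inverse moduli over a sector of the lattice. -/
theorem exists_sector_sum {q : ℕ} (hq : 1 ≤ q) {C : ℝ} (hC : 0 < C) {M : ℕ} (hM : 1 ≤ M) :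
    ∃ N, ∀ L : (Σ _ : ℕ, ℕ) → ℝ, (∀ p ∈ sector M N, 1 < L p) →
      (∀ p ∈ sector M N, L p ^ q ≤ C * ((p.1 + M : ℕ) : ℝ) ^ (q + 1)) →
      2 ≤ ∑ p ∈ sector M N, L p ^ (-(2 * q / (q + 1) : ℝ)) := by
  set c := C ^ (-(2 / (q + 1) : ℝ)) with hc
  have hc0 : 0 < c := Real.rpow_pos_of_pos hC _
  have hdiv : Tendsto (fun N => ∑ k ∈ Finset.range N, (1 / ((k + M : ℕ) : ℝ))) atTop atTop := by
    rw [← not_summable_iff_tendsto_nat_atTop_of_nonneg fun i => by positivity]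
    exact mt (summable_nat_add_iff (f := fun n : ℕ => (1 / (n : ℝ))) M).1
      Real.not_summable_one_div_natCast
  obtain ⟨N, hN⟩ := (hdiv.eventually_ge_atTop (2 / c)).exists
  refine ⟨N, fun L hL1 hL => ?_⟩
  rw [div_le_iff₀' hc0] at hN
  refine hN.trans ?_
  rw [sector, Finset.sum_sigma, Finset.mul_sum]
  refine Finset.sum_le_sum fun k hk => ?_
  have hm : (0 : ℝ) < ((k + M : ℕ) : ℝ) := by exact_mod_cast (by omega : 0 < k + M)
  -- Row `k` has `k + M` terms of this size, so it contributes at least `c / (k + M)`, a term of the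
  -- harmonic series.
  have key : ∀ n ∈ Finset.range (k + M), c * (((k + M : ℕ) : ℝ) ^ 2)⁻¹ ≤
      L ⟨k, n⟩ ^ (-(2 * q / (q + 1) : ℝ)) := by
    intro n hn
    have hmem : (⟨k, n⟩ : Σ _ : ℕ, ℕ) ∈ sector M N := Finset.mem_sigma.2 ⟨hk, hn⟩
    have h0 : 0 < L ⟨k, n⟩ := one_pos.trans (hL1 _ hmem)
    have h1 : L ⟨k, n⟩ ^ (-(2 * q / (q + 1) : ℝ)) = (L ⟨k, n⟩ ^ q) ^ (-(2 / (q + 1) : ℝ)) := by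
      rw [← Real.rpow_natCast, ← Real.rpow_mul h0.le]
      congr 1
      ring
    have h2 : c * (((k + M : ℕ) : ℝ) ^ 2)⁻¹ =
        (C * ((k + M : ℕ) : ℝ) ^ (q + 1)) ^ (-(2 / (q + 1) : ℝ)) := by
      rw [Real.mul_rpow hC.le (by positivity), ← hc, ← Real.rpow_natCast _ (q + 1),
        ← Real.rpow_mul hm.le]
      congr 1
      rw [← Real.rpow_natCast, ← Real.rpow_neg hm.le]
      congr 1
      push_cast
      field_simp
    rw [h1, h2]
    exact Real.rpow_le_rpow_of_nonpos (pow_pos h0 q) (hL _ hmem)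
      (neg_nonpos.2 (by positivity))
  calc c * (1 / ((k + M : ℕ) : ℝ))
      = ∑ n ∈ Finset.range (k + M), c * (((k + M : ℕ) : ℝ) ^ 2)⁻¹ := by
        rw [Finset.sum_const, Finset.card_range, nsmul_eq_mul]
        field_simp
    _ ≤ _ := Finset.sum_le_sum key

/-- A strict inequality for a finite sum of powers persists for slightly larger exponents. -/
theorem exists_exponent {ι : Type*} [Fintype ι] {L : ι → ℝ} (hL : ∀ i, 1 < L i) {s : ℝ}
    (hs : 0 ≤ s) (hsum : 1 < ∑ i, L i ^ (-s)) :
    ∃ t : NNReal, s < t ∧ 1 ≤ ∑ i, L i ^ (-(t : ℝ)) := by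
  have hc : Continuous fun t : ℝ => ∑ i, L i ^ (-t) :=
    continuous_finsetSum _ fun i _ =>
      Real.continuous_const_rpow (one_pos.trans (hL i)).ne' |>.comp continuous_neg
  have h1 : ∀ᶠ t in 𝓝[>] s, 1 < ∑ i, L i ^ (-t) :=
    eventually_nhdsWithin_of_eventually_nhds (hc.continuousAt.eventually_const_lt hsum)
  obtain ⟨t, ht, hst⟩ := (h1.and self_mem_nhdsWithin).exists
  exact ⟨⟨t, hs.trans (le_of_lt hst)⟩, hst, ht.le⟩

/-- Each term is at most `1`, so one index is not enough. Two symbols are needed for itineraries to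
separate. -/
theorem nontrivial_of_sum {ι : Type*} [Fintype ι] {L : ι → ℝ} (hL : ∀ i, 1 < L i) {s : ℝ}
    (hs : 0 ≤ s) (hsum : 1 < ∑ i, L i ^ (-s)) : Nontrivial ι := by
  rw [← Fintype.one_lt_card_iff_nontrivial]
  have h1 : ∑ i, L i ^ (-s) ≤ ∑ _i : ι, (1 : ℝ) := Finset.sum_le_sum fun i _ =>
    Real.rpow_le_one_of_one_le_of_nonpos (hL i).le (neg_nonpos.2 hs)
  simp only [Finset.sum_const, Finset.card_univ, nsmul_eq_mul, mul_one] at h1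
  exact_mod_cast hsum.trans_le h1

/-! ### Assembling the system from lattice translates of a pole -/

/-- Functions close to an elliptic function with a pole of multiplicity `q` have Julia sets of
dimension greater than `2q/(q+1)`. -/
theorem eventually_lt_sphereDim {f : ℂ → ℂ} (hf : IsElliptic f) {q : ℕ} {a : ℂ}
    (hp : HasPole f a q) {F : ℕ → ℂ → ℂ} (hF : ∀ n, IsMeromorphicFun (F n))
    (hlim : TendstoLocUnif (fun n => toSphere (F n)) (toSphere f) univ) :
    ∀ᶠ n in atTop, 2 * (q : ENNReal) / ((q : ENNReal) + 1) < sphereDim (juliaSet (F n)) := by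
  obtain ⟨-, -, ω₁, ω₂, hω, hp₁, hp₂⟩ := hf
  obtain ⟨c, hc, hlat⟩ := exists_lattice_bound hω
  -- Distinct translates of `a` are at least `c` apart, so radius `c / 3` gives the required
  -- separation `3 ε`.
  obtain ⟨C, hC, R, hR⟩ := exists_disc_near_pole hp (ε := c / 3) (by positivity)
  choose! ξ A ρ hρ hsub hana hd hval hA hA5 hAq using hR
  obtain ⟨M, hM⟩ := exists_nat_ge (max 1 ((R + ‖a‖) / c))
  have hM1 : 1 ≤ M := by exact_mod_cast (le_max_left _ _).trans hM
  have hMR : R + ‖a‖ ≤ c * M := by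
    rw [← div_le_iff₀' hc]
    exact (le_max_right _ _).trans hM
  set ω : (Σ _ : ℕ, ℕ) → ℂ := fun p => ((p.1 + M : ℕ) : ℂ) * ω₁ + (p.2 : ℂ) * ω₂ with hωdef
  have hper : ∀ p z, f (z + ω p) = f z := fun p z => by
    rw [hωdef]
    simp only
    rw [← add_assoc, (hp₂.nat_mul p.2) _, (hp₁.nat_mul (p.1 + M)) z]
  have hbig : ∀ p, R ≤ ‖a + ω p‖ := fun p => by
    have h1 := hlat ((p.1 + M : ℕ) : ℝ) (p.2 : ℝ)
    have h2 : c * M ≤ c * max |((p.1 + M : ℕ) : ℝ)| |(p.2 : ℝ)| := by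
      refine mul_le_mul_of_nonneg_left (le_trans ?_ (le_max_left _ _)) hc.le
      rw [Nat.abs_cast]
      exact_mod_cast Nat.le_add_left _ _
    rw [Complex.ofReal_natCast, Complex.ofReal_natCast] at h1
    have h3 := norm_sub_le (a + ω p) a
    rw [add_sub_cancel_left] at h3
    linarith
  set D := ‖a‖ + ‖ω₁‖ + ‖ω₂‖ + 1 with hD
  have hD0 : 0 < D := by positivity
  obtain ⟨N, hN⟩ := exists_sector_sum hp.1 (C := 2 ^ q * C * D ^ (q + 1)) (by positivity) hM1
  have hupper : ∀ p ∈ sector M N, ‖a + ω p‖ ≤ D * ((p.1 + M : ℕ) : ℝ) := by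
    intro p hpm
    have h1 : (p.2 : ℝ) ≤ ((p.1 + M : ℕ) : ℝ) := by
      have := Finset.mem_range.1 (Finset.mem_sigma.1 hpm).2
      exact_mod_cast this.le
    have h2 : (1 : ℝ) ≤ ((p.1 + M : ℕ) : ℝ) := by exact_mod_cast (by omega : 1 ≤ p.1 + M)
    have h3 : ‖a + ω p‖ ≤ ‖a‖ + (((p.1 + M : ℕ) : ℝ) * ‖ω₁‖ + (p.2 : ℝ) * ‖ω₂‖) := by
      refine (norm_add_le _ _).trans (add_le_add_right ((norm_add_le _ _).trans ?_) _)
      rw [norm_mul, norm_mul, Complex.norm_natCast, Complex.norm_natCast]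
    have h4 := mul_le_mul_of_nonneg_right h1 (norm_nonneg ω₂)
    have h5 := mul_le_mul_of_nonneg_right h2 (norm_nonneg a)
    rw [hD]
    linarith
  have hL1 : ∀ p, 1 < 2 * ‖A (a + ω p)‖ := fun p => by linarith [hA5 _ (hbig p)]
  have hs0 : (0 : ℝ) ≤ 2 * q / (q + 1) := by positivity
  have hsum := hN (fun p => 2 * ‖A (a + ω p)‖) (fun p _ => hL1 p) fun p hpm => by
    calc (2 * ‖A (a + ω p)‖) ^ q = 2 ^ q * ‖A (a + ω p)‖ ^ q := mul_pow _ _ _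
      _ ≤ 2 ^ q * (C * (D * ((p.1 + M : ℕ) : ℝ)) ^ (q + 1)) := by
        refine mul_le_mul_of_nonneg_left ((hAq _ (hbig p)).trans ?_) (by positivity)
        exact mul_le_mul_of_nonneg_left (pow_le_pow_left₀ (norm_nonneg _) (hupper p hpm) _) hC.le
      _ = _ := by
        rw [mul_pow]
        ring
  rw [← Finset.sum_coe_sort] at hsum
  have hL1' : ∀ p : sector M N, 1 < 2 * ‖A (a + ω p)‖ := fun p => hL1 p
  have := nontrivial_of_sum hL1' hs0 (by linarith)
  obtain ⟨t, hst, ht⟩ := exists_exponent hL1' hs0 (by linarith)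
  have htrans : ∀ p j r z, z ∈ Metric.closedBall (ξ (a + ω j) + ω p) r →
      z - ω p ∈ Metric.closedBall (ξ (a + ω j)) r := fun p j r z hz => by
    rw [Metric.mem_closedBall, dist_eq_norm] at hz ⊢
    rwa [sub_sub, add_comm]
  have hper' : ∀ p, f = fun z => f (z - ω p) := fun p => funext fun z => by
    rw [← hper p (z - ω p), sub_add_cancel]
  -- The disc near `a` with value `a + ω j` at its centre is translated by `ω p`; periodicity leaves
  -- its slope and radius independent of `p`.
  have hsys := eventually_isMarkovSystem (ι := sector M N) hF hlim (b := fun p => a + ω p)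
    (ξ := fun p j => ξ (a + ω j) + ω p) (A := fun p => A (a + ω p)) (ρ := fun p => ρ (a + ω p))
    (ε := c / 3) (by positivity)
    (by
      intro p p' hpp
      have h1 : a + ω p - (a + ω p') =
          (((p.1.1 : ℝ) - p'.1.1 : ℝ) : ℂ) * ω₁ + (((p.1.2 : ℝ) - p'.1.2 : ℝ) : ℂ) * ω₂ := by
        simp only [hωdef]
        push_cast
        ring
      have h2 : 1 ≤ max |(p.1.1 : ℝ) - p'.1.1| |(p.1.2 : ℝ) - p'.1.2| := by
        have hint : ∀ m n : ℕ, m ≠ n → 1 ≤ |(m : ℝ) - n| := fun m n hmn => by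
          have : (1 : ℤ) ≤ |(m : ℤ) - n| := Int.one_le_abs (by omega)
          exact_mod_cast this
        by_cases h : p.1.1 = p'.1.1
        · refine (hint _ _ fun h' => hpp (Subtype.ext ?_)).trans (le_max_right _ _)
          exact Sigma.ext h (heq_of_eq h')
        · exact (hint _ _ h).trans (le_max_left _ _)
      rw [dist_eq_norm, h1]
      refine le_trans ?_ (hlat _ _)
      nlinarith)
    (fun p => hρ _ (hbig p))
    (by
      intro p j z hz
      have h1 := hsub _ (hbig j) (htrans p j _ z (Metric.closedBall_subset_closedBall
        (by linarith [hρ _ (hbig j)]) hz))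
      rw [Metric.mem_closedBall, dist_eq_norm] at h1 ⊢
      rwa [sub_sub, add_comm (ω p)] at h1)
    (by
      intro p j z hz
      rw [hper' p]
      exact AnalyticAt.comp (hana _ (hbig j) _ (htrans p j _ z hz))
        (analyticAt_id.sub analyticAt_const))
    (by
      intro p j z hz
      have h1 : deriv f z = deriv f (z - ω p) := by
        conv_lhs => rw [hper' p, deriv_comp_sub_const]
      rw [h1]
      exact hd _ (hbig j) _ (htrans p j _ z hz))
    (fun p j => by rw [hper, hval _ (hbig j)])
    (fun p => hA _ (hbig p)) (fun p => hA5 _ (hbig p))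
  filter_upwards [hsys] with n ⟨P, hP, hmk⟩
  have ht0 : 0 < t := by exact_mod_cast hs0.trans_lt hst
  refine lt_of_lt_of_le ?_ (hmk.le_sphereDim hP hL1' t ht0 ht)
  have h1 : 2 * (q : ENNReal) / ((q : ENNReal) + 1) =
      ((2 * (q : NNReal) / ((q : NNReal) + 1) : NNReal) : ENNReal) := by
    rw [ENNReal.coe_div (by positivity)]
    push_cast
    rfl
  rw [h1, ENNReal.coe_lt_coe, ← NNReal.coe_lt_coe]
  push_cast
  exact hst

end MeromorphicDynamics

theorem mainTheorem3 (f : ℂ → ℂ) (hf : MeromorphicDynamics.IsElliptic f)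
    (q : ℕ) (hq : IsGreatest {m : ℕ | ∃ a : ℂ, MeromorphicDynamics.HasPole f a m} q) :
    2 * (q : ENNReal) / ((q : ENNReal) + 1) <
        MeromorphicDynamics.sphereDim (MeromorphicDynamics.juliaSet f) ∧
    ∀ F : ℕ → ℂ → ℂ, (∀ n, MeromorphicDynamics.IsMeromorphicFun (F n)) →
      MeromorphicDynamics.TendstoLocUnif (fun n => MeromorphicDynamics.toSphere (F n))
        (MeromorphicDynamics.toSphere f) univ →
      ∀ᶠ n in atTop, 2 * (q : ENNReal) / ((q : ENNReal) + 1) <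
        MeromorphicDynamics.sphereDim (MeromorphicDynamics.juliaSet (F n)) := by
  obtain ⟨a, ha⟩ := hq.1
  refine ⟨?_, fun F hF hlim => MeromorphicDynamics.eventually_lt_sphereDim hf ha hF hlim⟩
  -- The bound for `f` itself is the case of the constant sequence.
  refine (MeromorphicDynamics.eventually_lt_sphereDim hf ha (F := fun _ => f) (fun _ => hf.1)
    fun K _ _ ε hε => Eventually.of_forall fun _ z _ => ?_).exists.elim fun _ h => h
  rw [MeromorphicDynamics.chordalDist_self]
  exact hε
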